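/- Let $K$ be a field of characteristic $0$ and let $R=K[X_{ij} : 1\le i\le n,\ 1\le j\le l_i]$ be the polynomial ring graded by $\deg X_{ij}=q_i$, where $0<q_1<q_2<\dots<q_n$ are integers. Let $>$ be a term order on $R$ such that $X_{ij}>X_{ik}$ for all $i$ and all $j<k$, and such that $m>X_{ij}$ for all $i,j$ and every monomial $m$ of degree $q_i$ in the variables $X_{hk}$ with $h<i$. A graded automorphism of $R$ is a degree-preserving $K$-algebra automorphism; it has the form $$\phi(X_{ij})=\sum_{h=1}^{l_i}a^i_{hj}X_{ih}+\psi_{ij},$$ where the matrices $A_i=(a^i_{hj})_{h,j}$ ($h$ the row index, $j$ the column index) are invertible and $\psi_{ij}$ is homogeneous of degree $q_i$ in the variables $X_{hk}$ with $h<i$. The Zariski topology on the set of graded automorphisms is the one given by the coefficients of the polynomials $\phi(X_{ij})$. Let $T$ be the set of graded automorphisms for which all $A_i$ are upper triangular, i.e. $\phi(X_{ij})$ is a linear combination of $X_{i1},\dots,X_{ij}$ plus $\psi_{ij}$. Let $I\subseteq R$ be a homogeneous ideal. Then there is exactly one ideal $\operatorname{Gin}(I)$ of $R$ such that $\operatorname{in}_>(\phi(I))=\operatorname{Gin}(I)$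 for all $\phi$ in some nonempty Zariski open set of graded automorphisms, and this ideal is $T$-fixed: $\phi(\operatorname{Gin}(I))=\operatorname{Gin}(I)$ for all $\phi\in T$. -/

import Mathlib

open MvPolynomial
open scoped MonomialOrder

attribute [local instance] MvPolynomial.weightedGradedAlgebra

namespace WeightedGin

/-- The index set of the variables `X_{ij}`: `i` is the block, `j` the position in the block. -/
abbrev Idx {n : ℕ} (l : Fin n → ℕ) : Type := Σ i : Fin n, Fin (l i)

/-- The weight vector: every variable of block `i` has weight `q i`. -/
def wt {n : ℕ} (l : Fin n → ℕ) (q : Fin n → ℕ) : Idx l → ℕ := fun v => q v.1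

/-- The initial ideal of `I`: the ideal generated by the leading terms of its elements. -/
noncomputable def initialIdeal {σ K : Type*} [Field K] (m : MonomialOrder σ)
    (I : Ideal (MvPolynomial σ K)) : Ideal (MvPolynomial σ K) :=
  Ideal.span (m.leadingTerm '' (I : Set (MvPolynomial σ K)))

/-- The graded automorphisms of the polynomial ring with weights `w`: the `K`-algebra
automorphisms that send homogeneous polynomials of degree `d` to homogeneous polynomials of
degree `d`, for every `d`. -/
abbrev GradedAut {σ : Type*} (K : Type*) [Field K] (w : σ → ℕ) :=
  {φ : MvPolynomial σ K ≃ₐ[K] MvPolynomial σ K //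
    ∀ (d : ℕ) (f : MvPolynomial σ K), IsWeightedHomogeneous w f d →
      IsWeightedHomogeneous w (φ f) d}

/-- The coordinates of a graded automorphism: at `(v, a)`, the coefficient of the monomial with
exponent `a` in the image of the variable `X v` (it vanishes unless `a` has the degree of `X v`,
so that only finitely many coordinates matter). -/
noncomputable def coords {σ K : Type*} [Field K] {w : σ → ℕ} (φ : GradedAut K w) :
    σ × (σ →₀ ℕ) → K :=
  fun p => coeff p.2 (φ.1 (X p.1))

/-- A set of graded automorphisms is Zariski open if it is the set of points at which not all
polynomials of some set `S` of polynomials in the coordinates vanish. -/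
def IsZariskiOpen {σ K : Type*} [Field K] {w : σ → ℕ} (U : Set (GradedAut K w)) : Prop :=
  ∃ S : Set (MvPolynomial (σ × (σ →₀ ℕ)) K),
    U = {φ | ∃ P ∈ S, eval (coords φ) P ≠ 0}

/-- `J` is a generic initial ideal of `I`: it is the initial ideal of `φ(I)` for all `φ` in a
nonempty Zariski open set of graded automorphisms. -/
def IsGin {σ K : Type*} [Field K] (m : MonomialOrder σ) (w : σ → ℕ)
    (I J : Ideal (MvPolynomial σ K)) : Prop :=
  ∃ U : Set (GradedAut K w), IsZariskiOpen U ∧ U.Nonempty ∧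
    ∀ φ ∈ U, initialIdeal m (I.map φ.1) = J

/-- The linear part of `φ` on block `i`: column `j` holds the coefficients of `X_{i1}, …, X_{il_i}`
in `φ(X_{ij})`. -/
noncomputable def linearPart {n : ℕ} {l q : Fin n → ℕ} {K : Type*} [Field K]
    (φ : GradedAut K (wt l q)) (i : Fin n) : Matrix (Fin (l i)) (Fin (l i)) K :=
  Matrix.of fun h j => coeff (Finsupp.single (⟨i, h⟩ : Idx l) 1) (φ.1 (X (⟨i, j⟩ : Idx l)))

/-- The set `T` of upper triangular automorphisms: all linear parts are upper triangular, that is,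
`φ(X_{ij})` is a linear combination of `X_{i1}, …, X_{ij}` plus a polynomial in the variables of
the preceding blocks. -/
def upperTriangular {n : ℕ} (l q : Fin n → ℕ) (K : Type*) [Field K] :
    Set (GradedAut K (wt l q)) :=
  {φ | ∀ i : Fin n, (linearPart φ i).BlockTriangular id}

end WeightedGin

/-! Everything is expressed through ranks: for a finite set `S` of exponents, `rankOn S W` is the
dimension of the projection of `W` to the coordinates in `S`. If `S` is an upper segment of one
weight, Gaussian elimination shows that the rank of a homogeneous ideal on `S` counts its leading
exponents in `S` (`rankOn_eq_card_leadExp`). So the ranks on upper segments determine the initial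
ideal.

As a function of `φ`, the rank of `φ(I)` on `S` is lower semicontinuous, because minors are
polynomials in the coordinates of `φ` (`isZariskiOpen_le_autRank`). Graded automorphisms form an
irreducible set (`exists_eval_ne_zero`), so finitely many ranks can be made maximal at once. The
exponents at which the maximal rank jumps are the candidates for the generic initial ideal.
Prescribing only finitely many generators of the candidate ideal gives one inclusion on an open set.
Equality follows because all `φ(I)` have the same Hilbert function. Uniqueness is irreducibility
again.

For invariance, let `J = in(φ₀(I))` have maximal ranks. Degenerating by torus scalings shows that no
rank of `τ(J)` exceeds the maximum for `I` (`exists_rankOn_map_initialIdeal_le`). An upper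
triangular `τ` only raises monomials. If `c` were the largest monomial of `J`, within its weight,
with `τ(c)` outside `J`, then above `c` the rank of `τ(J)` would exceed that of `J`, which is
already maximal (`map_monomial_mem_initialIdeal`). -/

namespace WeightedGin

/-! ### Ranks on finite sets of coordinates and leading positions. -/

section Rank

variable {σ K : Type*} [Field K]

/-- The linear map that reads off the coefficients of the monomials in `S`. -/
noncomputable def coeffOn (S : Finset (σ →₀ ℕ)) : MvPolynomial σ K →ₗ[K] (S → K) :=
  LinearMap.pi fun c => lcoeff K c.1

@[simp] lemma coeffOn_apply (S : Finset (σ →₀ ℕ)) (f : MvPolynomial σ K) (c : S) :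
    coeffOn S f c = coeff c.1 f := rfl

/-- The dimension of the projection of `W` to the coordinates in `S`. -/
noncomputable def rankOn (S : Finset (σ →₀ ℕ)) (W : Submodule K (MvPolynomial σ K)) : ℕ :=
  Module.finrank K (W.map (coeffOn S))

lemma rankOn_le_card (S : Finset (σ →₀ ℕ)) (W : Submodule K (MvPolynomial σ K)) :
    rankOn S W ≤ S.card := by
  simpa [rankOn] using Submodule.finrank_le (W.map (coeffOn S))

lemma rankOn_empty (W : Submodule K (MvPolynomial σ K)) : rankOn ∅ W = 0 := by
  simpa using rankOn_le_card ∅ W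

-- The kernel of `r` on `V` embeds into `K` through `e`, so it has dimension 0 or 1. This measures
-- the effect of forgetting one coordinate.
open Classical in
lemma finrank_eq_finrank_map_add {M N : Type*} [AddCommGroup M] [Module K M]
    [FiniteDimensional K M] [AddCommGroup N] [Module K N] (V : Submodule K M) (r : M →ₗ[K] N)
    (e : M →ₗ[K] K) (he : ∀ x, r x = 0 → e x = 0 → x = 0) :
    Module.finrank K V = Module.finrank K (V.map r) +
      if ∃ x ∈ V, e x ≠ 0 ∧ r x = 0 then 1 else 0 := by
  have h1 := LinearMap.finrank_range_add_finrank_ker (r.domRestrict V)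
  rw [LinearMap.range_domRestrict] at h1
  rw [← h1, add_right_inj]
  have hle : Module.finrank K (LinearMap.ker (r.domRestrict V)) ≤ 1 := by
    have hinj : Function.Injective
        ((e.domRestrict V).domRestrict (LinearMap.ker (r.domRestrict V))) := by
      intro x y hxy
      have h0 : (x.1.1 - y.1.1 : M) = 0 := by
        refine he _ ?_ ?_
        · rw [map_sub, sub_eq_zero]
          exact (LinearMap.mem_ker.1 x.2).trans (LinearMap.mem_ker.1 y.2).symm
        · rw [map_sub, sub_eq_zero]
          exact hxy
      exact Subtype.ext (Subtype.ext (sub_eq_zero.1 h0))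
    simpa using LinearMap.finrank_le_finrank_of_injective hinj
  split_ifs with h
  · obtain ⟨x, hx, hxe, hxr⟩ := h
    refine le_antisymm hle (Nat.one_le_iff_ne_zero.2 fun h0 => ?_)
    rw [Submodule.finrank_eq_zero] at h0
    have hmem : (⟨x, hx⟩ : V) ∈ LinearMap.ker (r.domRestrict V) := hxr
    rw [h0, Submodule.mem_bot] at hmem
    have hx0 : x = 0 := congrArg Subtype.val hmem
    exact hxe (by rw [hx0, map_zero])
  · rw [Submodule.finrank_eq_zero, Submodule.eq_bot_iff]
    rintro ⟨x, hx⟩ hxr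
    have hxr' : r x = 0 := hxr
    exact Subtype.ext (he x hxr' (by_contra fun hxe => h ⟨x, hx, hxe, hxr'⟩))

open Classical in
lemma rankOn_insert (S : Finset (σ →₀ ℕ)) (a : σ →₀ ℕ) (W : Submodule K (MvPolynomial σ K)) :
    rankOn (insert a S) W = rankOn S W +
      if ∃ f ∈ W, coeff a f ≠ 0 ∧ ∀ c ∈ S, coeff c f = 0 then 1 else 0 := by
  let r : (↥(insert a S : Finset (σ →₀ ℕ)) → K) →ₗ[K] (S → K) :=
    LinearMap.funLeft K K fun c => ⟨c.1, Finset.mem_insert_of_mem c.2⟩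
  have hr : (W.map (coeffOn (insert a S))).map r = W.map (coeffOn S) := by
    rw [← Submodule.map_comp]; rfl
  have ha : a ∈ insert a S := Finset.mem_insert_self a S
  unfold rankOn
  rw [finrank_eq_finrank_map_add (W.map (coeffOn (insert a S))) r (LinearMap.proj ⟨a, ha⟩), hr]
  · congr 2
    apply propext
    constructor
    · rintro ⟨_, ⟨f, hf, rfl⟩, hfa, hfS⟩
      exact ⟨f, hf, hfa, fun c hc => congrFun hfS ⟨c, hc⟩⟩
    · rintro ⟨f, hf, hfa, hfS⟩
      exact ⟨_, Submodule.mem_map_of_mem hf, hfa, funext fun c => hfS c.1 c.2⟩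
  · rintro x hxr hxa
    funext ⟨c, hc⟩
    rcases Finset.mem_insert.1 hc with rfl | hc'
    · exact hxa
    · exact congrFun hxr ⟨c, hc'⟩

open Classical in
/-- The rank is the number of positions of leading coefficients. -/
lemma rankOn_eq_card_filter (m : MonomialOrder σ) (W : Submodule K (MvPolynomial σ K))
    (S : Finset (σ →₀ ℕ)) :
    rankOn S W = (S.filter fun c =>
      ∃ f ∈ W, coeff c f ≠ 0 ∧ ∀ c' ∈ S, c ≺[m] c' → coeff c' f = 0).card := by
  -- Exponents are inserted from the largest down: the new `a` lies below all of `S`, so the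
  -- conditions at earlier exponents do not change.
  induction S using Finset.induction_on_min_value m.toSyn with
  | empty => simpa using rankOn_empty W
  | insert a S haS hmin ih =>
    have hlt : ∀ c ∈ S, a ≺[m] c := fun c hc =>
      lt_of_le_of_ne (hmin c hc) fun h => haS (m.toSyn.injective h ▸ hc)
    rw [rankOn_insert, ih, Finset.filter_insert]
    have h1 : (∃ f ∈ W, coeff a f ≠ 0 ∧ ∀ c ∈ S, coeff c f = 0) ↔
        ∃ f ∈ W, coeff a f ≠ 0 ∧ ∀ c' ∈ insert a S, a ≺[m] c' → coeff c' f = 0 := by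
      refine exists_congr fun f => and_congr_right fun _ => and_congr_right fun _ => ?_
      constructor
      · intro h c hc hac
        rcases Finset.mem_insert.1 hc with rfl | hc
        · exact absurd hac (lt_irrefl _)
        · exact h c hc
      · intro h c hc
        exact h c (Finset.mem_insert_of_mem hc) (hlt c hc)
    have h2 : (S.filter fun c =>
        ∃ f ∈ W, coeff c f ≠ 0 ∧ ∀ c' ∈ insert a S, c ≺[m] c' → coeff c' f = 0) =
        S.filter fun c => ∃ f ∈ W, coeff c f ≠ 0 ∧ ∀ c' ∈ S, c ≺[m] c' → coeff c' f = 0 := by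
      refine Finset.filter_congr fun c hc => ?_
      refine exists_congr fun f => and_congr_right fun _ => and_congr_right fun _ => ?_
      constructor
      · intro h c' hc'
        exact h c' (Finset.mem_insert_of_mem hc')
      · intro h c' hc' hcc'
        rcases Finset.mem_insert.1 hc' with rfl | hc'
        · exact absurd hcc' (hlt c hc).asymm
        · exact h c' hc' hcc'
    rw [h2]
    by_cases h : ∃ f ∈ W, coeff a f ≠ 0 ∧ ∀ c ∈ S, coeff c f = 0
    · rw [if_pos h, if_pos (h1.1 h), Finset.card_insert_of_notMem]
      simp [haS]
    · rw [if_neg h, if_neg (mt h1.2 h), add_zero]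

/-- A nonvanishing minor bounds the rank from below. -/
lemma le_rankOn_of_det_ne_zero {k : ℕ} {S : Finset (σ →₀ ℕ)} {W : Submodule K (MvPolynomial σ K)}
    {f : Fin k → MvPolynomial σ K} (hf : ∀ j, f j ∈ W) (G : (S → K) →ₗ[K] (Fin k → K))
    (h : (Matrix.of fun i j => G (coeffOn S (f j)) i).det ≠ 0) : k ≤ rankOn S W := by
  have h1 := Matrix.linearIndependent_cols_of_det_ne_zero h
  have h2 : LinearIndependent K fun j => G (coeffOn S (f j)) := h1
  have h3 : LinearIndependent K fun j => coeffOn S (f j) := LinearIndependent.of_comp G h2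
  let g : Fin k → W.map (coeffOn S) := fun j => ⟨coeffOn S (f j), Submodule.mem_map_of_mem (hf j)⟩
  have h4 : LinearIndependent K g := LinearIndependent.of_comp (W.map (coeffOn S)).subtype h3
  simpa [rankOn] using h4.fintype_card_le_finrank

/-- The rank of the span of `X` is witnessed by a nonvanishing minor with columns in `X`. -/
lemma exists_det_ne_zero (S : Finset (σ →₀ ℕ)) (X : Set (MvPolynomial σ K)) :
    ∃ (f : Fin (rankOn S (Submodule.span K X)) → MvPolynomial σ K)
      (G : (S → K) →ₗ[K] (Fin (rankOn S (Submodule.span K X)) → K)),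
      (∀ j, f j ∈ X) ∧ (Matrix.of fun i j => G (coeffOn S (f j)) i).det ≠ 0 := by
  unfold rankOn
  rw [Submodule.map_span]
  obtain ⟨v, hv, -, hli⟩ := Submodule.exists_fun_fin_finrank_span_eq K (coeffOn S '' X)
  choose f hf hfv using hv
  -- A left inverse `G` of the inclusion of a basis takes the place of a choice of rows; the minor
  -- becomes the identity matrix.
  obtain ⟨G, hG⟩ := LinearMap.exists_leftInverse_of_injective (Fintype.linearCombination K v)
    (LinearMap.ker_eq_bot.2 hli.fintypeLinearCombination_injective)
  refine ⟨f, G, hf, ?_⟩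
  have : (Matrix.of fun i j => G (coeffOn S (f j)) i) = 1 := by
    ext i j
    have := congrFun (LinearMap.congr_fun hG (Pi.single j 1)) i
    rw [LinearMap.comp_apply, Fintype.linearCombination_apply_single, one_smul] at this
    simp only [Matrix.of_apply, hfv, this, LinearMap.id_apply, Matrix.one_apply, Pi.single_apply]
  rw [this, Matrix.det_one]
  exact one_ne_zero

end Rank

open scoped Classical

/-- A surjective endomorphism of a noetherian ring that maps an ideal into itself reflects
membership in the ideal. -/
lemma mem_of_map_mem_of_surjective {R : Type*} [CommRing R] [IsNoetherianRing R] (f : R →+* R)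
    (hf : Function.Surjective f) {J : Ideal R} (hJ : J ≤ J.comap f) {x : R} (hx : f x ∈ J) :
    x ∈ J := by
  -- The ascending chain of preimages of `J` stabilizes at some `n`. Writing `x` as `f ^ n` of some
  -- `y`, the equality of the preimages at `n` and `n + 1` gives the claim.
  let c : ℕ →o Ideal R := ⟨fun n => J.comap (f ^ n), monotone_nat_of_le_succ fun n y hy => by
    rw [Ideal.mem_comap, pow_succ', RingHom.mul_def, RingHom.comp_apply]
    exact hJ hy⟩
  obtain ⟨n, hn⟩ := monotone_stabilizes_iff_noetherian.2 ‹IsNoetherianRing R› c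
  have hsurj : Function.Surjective (f ^ n) := by
    rw [RingHom.coe_pow]
    exact hf.iterate n
  obtain ⟨y, rfl⟩ := hsurj x
  have hy : y ∈ c (n + 1) := by
    change (f ^ (n + 1)) y ∈ J
    rwa [pow_succ', RingHom.mul_def, RingHom.comp_apply]
  rw [← hn (n + 1) n.le_succ] at hy
  exact hy

/-! ### Graded automorphisms as points of an affine space. -/

section Generic

variable {σ K : Type*} [Field K]

lemma isWeightedHomogeneous_algHom {w : σ → ℕ} (g : MvPolynomial σ K →ₐ[K] MvPolynomial σ K)
    (hg : ∀ v, IsWeightedHomogeneous w (g (X v)) (w v)) {d : ℕ} {f : MvPolynomial σ K}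
    (hf : IsWeightedHomogeneous w f d) : IsWeightedHomogeneous w (g f) d := by
  rw [f.as_sum, map_sum]
  refine IsWeightedHomogeneous.sum _ _ _ fun a ha => ?_
  rw [monomial_eq, map_mul, ← algebraMap_eq, AlgHom.commutes, algebraMap_eq]
  refine IsWeightedHomogeneous.C_mul ?_ _
  rw [← hf (mem_support_iff.1 ha), Finsupp.prod, map_prod, Finsupp.weight_apply, Finsupp.sum]
  refine IsWeightedHomogeneous.prod _ _ _ fun v _ => ?_
  rw [map_pow, smul_eq_mul]
  exact (hg v).pow _

lemma coords_eq_zero {w : σ → ℕ} (φ : GradedAut K w) (v : σ) (a : σ →₀ ℕ) (h : Finsupp.weight w a ≠ w v) :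
    coords φ (v, a) = 0 :=
  (φ.2 _ _ (isWeightedHomogeneous_X K w v)).coeff_eq_zero a h

lemma IsZariskiOpen.inter {w : σ → ℕ} {U V : Set (GradedAut K w)} (hU : IsZariskiOpen U)
    (hV : IsZariskiOpen V) : IsZariskiOpen (U ∩ V) := by
  obtain ⟨S, rfl⟩ := hU
  obtain ⟨S', rfl⟩ := hV
  refine ⟨Set.image2 (· * ·) S S', ?_⟩
  ext φ
  constructor
  · rintro ⟨⟨P, hP, hP0⟩, ⟨Q, hQ, hQ0⟩⟩
    exact ⟨P * Q, ⟨P, hP, Q, hQ, rfl⟩, by rw [map_mul]; exact mul_ne_zero hP0 hQ0⟩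
  · rintro ⟨_, ⟨P, hP, Q, hQ, rfl⟩, h⟩
    rw [map_mul] at h
    exact ⟨⟨P, hP, left_ne_zero_of_mul h⟩, ⟨Q, hQ, right_ne_zero_of_mul h⟩⟩

variable [Finite σ]

/-- The finite set of exponents of weight `d`. -/
noncomputable def expo (w : σ → ℕ) (hw : ∀ v, w v ≠ 0) (d : ℕ) : Finset (σ →₀ ℕ) :=
  (Finsupp.finite_of_nat_weight_eq w hw d).toFinset

variable {w : σ → ℕ} (hw : ∀ v, w v ≠ 0)

@[simp] lemma mem_expo {d : ℕ} {a : σ →₀ ℕ} : a ∈ expo w hw d ↔ Finsupp.weight w a = d := by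
  simp [expo]

/-- The endomorphism of the polynomial ring with generic coefficients. -/
noncomputable def genericHom :
    MvPolynomial σ K →ₐ[K] MvPolynomial σ (MvPolynomial (σ × (σ →₀ ℕ)) K) :=
  aeval fun v => ∑ a ∈ expo w hw (w v), monomial a (X (v, a))

/-- The graded endomorphism with given coordinates. -/
noncomputable def specialHom (x : σ × (σ →₀ ℕ) → K) : MvPolynomial σ K →ₐ[K] MvPolynomial σ K :=
  aeval fun v => ∑ a ∈ expo w hw (w v), monomial a (x (v, a))

lemma map_genericHom (x : σ × (σ →₀ ℕ) → K) (f : MvPolynomial σ K) :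
    map (eval x) (genericHom hw f) = specialHom hw x f := by
  have h : (mapAlgHom (aeval x)).comp (genericHom hw) = specialHom hw x := by
    refine algHom_ext fun v => ?_
    simp [genericHom, specialHom]
  rw [← h]
  simp

lemma eval_coeff_genericHom (x : σ × (σ →₀ ℕ) → K) (f : MvPolynomial σ K) (c : σ →₀ ℕ) :
    eval x (coeff c (genericHom hw f)) = coeff c (specialHom hw x f) := by
  rw [← map_genericHom, coeff_map]

lemma coeff_specialHom_X (x : σ × (σ →₀ ℕ) → K) (v : σ) (a : σ →₀ ℕ) :
    coeff a (specialHom hw x (X v)) = if Finsupp.weight w a = w v then x (v, a) else 0 := by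
  classical
  simp [specialHom, coeff_sum, coeff_monomial]

lemma specialHom_coords (φ : GradedAut K w) (f : MvPolynomial σ K) :
    specialHom hw (coords φ) f = φ.1 f := by
  have h : specialHom hw (coords φ) = φ.1.toAlgHom := by
    refine algHom_ext fun v => ?_
    ext a
    rw [coeff_specialHom_X]
    split_ifs with h
    · rfl
    · exact ((φ.2 _ _ (isWeightedHomogeneous_X K w v)).coeff_eq_zero a h).symm
  rw [h]; rfl

lemma isWeightedHomogeneous_specialHom (x : σ × (σ →₀ ℕ) → K) {d : ℕ} {f : MvPolynomial σ K}
    (hf : IsWeightedHomogeneous w f d) : IsWeightedHomogeneous w (specialHom hw x f) d := by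
  refine isWeightedHomogeneous_algHom _ (fun v a ha => ?_) hf
  rw [coeff_specialHom_X] at ha
  by_contra h
  exact ha (if_neg h)

variable (K) in
/-- The determinant of the generic graded endomorphism on the component of degree `d`. -/
noncomputable def degDet (d : ℕ) : MvPolynomial (σ × (σ →₀ ℕ)) K :=
  (Matrix.of fun c b : expo w hw d => coeff c.1 (genericHom hw (monomial b.1 (1 : K)))).det

lemma eval_degDet (x : σ × (σ →₀ ℕ) → K) (d : ℕ) :
    eval x (degDet K hw d) = (Matrix.of fun c b : expo w hw d =>
      coeff c.1 (specialHom hw x (monomial b.1 1))).det := by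
  rw [degDet, RingHom.map_det]
  congr 1
  ext c b
  simp [eval_coeff_genericHom]

lemma coeff_map_sum_monomial (g : MvPolynomial σ K →ₐ[K] MvPolynomial σ K) (d : ℕ)
    (u : expo w hw d → K) (c : expo w hw d) :
    coeff c.1 (g (∑ b, monomial b.1 (u b))) =
      (Matrix.of fun c b : expo w hw d => coeff c.1 (g (monomial b.1 1))).mulVec u c := by
  simp only [map_sum, coeff_sum, Matrix.mulVec, dotProduct, Matrix.of_apply]
  refine Finset.sum_congr rfl fun b _ => ?_
  have : monomial b.1 (u b) = u b • monomial b.1 (1 : K) := by rw [smul_monomial, smul_eq_mul, mul_one]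
  rw [this, map_smul, coeff_smul, smul_eq_mul, mul_comm]

lemma isWeightedHomogeneous_sum_monomial (d : ℕ) (u : expo w hw d → K) :
    IsWeightedHomogeneous w (∑ b, monomial b.1 (u b)) d :=
  IsWeightedHomogeneous.sum _ _ _ fun b _ =>
    isWeightedHomogeneous_monomial w _ _ ((mem_expo hw).1 b.2)

/-- A kernel vector of the matrix would be a nonzero homogeneous polynomial killed by the injective
`φ`. -/
lemma eval_coords_degDet_ne_zero (φ : GradedAut K w) (d : ℕ) :
    eval (coords φ) (degDet K hw d) ≠ 0 := by
  rw [eval_degDet]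
  intro h
  obtain ⟨u, hu, hu0⟩ := Matrix.exists_mulVec_eq_zero_iff.2 h
  have h0 : specialHom hw (coords φ) (∑ b, monomial b.1 (u b)) = 0 := by
    ext c
    by_cases hc : Finsupp.weight w c = d
    · have := coeff_map_sum_monomial hw (specialHom hw (coords φ)) d u ⟨c, (mem_expo hw).2 hc⟩
      rw [hu0] at this
      simpa using this
    · rw [(isWeightedHomogeneous_specialHom hw _
        (isWeightedHomogeneous_sum_monomial hw d u)).coeff_eq_zero c hc, coeff_zero]
  rw [specialHom_coords, map_eq_zero_iff _ φ.1.injective] at h0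
  apply hu
  funext b
  have := congrArg (coeff b.1) h0
  classical
  simpa [coeff_sum, coeff_monomial, Subtype.ext_iff.symm] using this

lemma exists_specialHom_eq (x : σ × (σ →₀ ℕ) → K) {d : ℕ} (h : eval x (degDet K hw d) ≠ 0)
    {f : MvPolynomial σ K} (hf : IsWeightedHomogeneous w f d) : ∃ g, specialHom hw x g = f := by
  rw [eval_degDet] at h
  obtain ⟨u, hu⟩ := (Matrix.mulVec_surjective_iff_isUnit.2
    ((Matrix.isUnit_iff_isUnit_det _).2 (isUnit_iff_ne_zero.2 h))) fun c => coeff c.1 f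
  refine ⟨∑ b, monomial b.1 (u b), ?_⟩
  ext c
  by_cases hc : Finsupp.weight w c = d
  · have := coeff_map_sum_monomial hw (specialHom hw x) d u ⟨c, (mem_expo hw).2 hc⟩
    rw [hu] at this
    exact this
  · rw [(isWeightedHomogeneous_specialHom hw _
      (isWeightedHomogeneous_sum_monomial hw d u)).coeff_eq_zero c hc, hf.coeff_eq_zero c hc]

/-- Coordinates with nonzero determinants belong to a graded automorphism. -/
lemma exists_gradedAut (x : σ × (σ →₀ ℕ) → K) (h : ∀ v, eval x (degDet K hw (w v)) ≠ 0)
    (hx : ∀ v a, Finsupp.weight w a ≠ w v → x (v, a) = 0) :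
    ∃ φ : GradedAut K w, coords φ = x := by
  -- Only the weights of the variables are needed: once every variable is in the range, the
  -- endomorphism is onto, and injectivity follows since the ring is noetherian.
  have hsurj : Function.Surjective (specialHom hw x) := by
    rw [← AlgHom.range_eq_top, eq_top_iff, ← adjoin_range_X, Algebra.adjoin_le_iff]
    rintro _ ⟨v, rfl⟩
    exact exists_specialHom_eq hw x (h v) (isWeightedHomogeneous_X K w v)
  have hinj : Function.Injective (specialHom hw x) :=
    (injective_iff_map_eq_zero _).2 fun f hf =>
      mem_of_map_mem_of_surjective (specialHom hw x).toRingHom hsurj bot_le hf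
  refine ⟨⟨AlgEquiv.ofBijective (specialHom hw x) ⟨hinj, hsurj⟩, fun d f hf =>
    isWeightedHomogeneous_specialHom hw x hf⟩, ?_⟩
  funext ⟨v, a⟩
  refine (coeff_specialHom_X hw x v a).trans ?_
  split_ifs with ha
  · rfl
  · exact (hx v a ha).symm

/-! ### Irreducibility: joining two automorphisms by a line. -/

/-- The restriction of a polynomial function to the line through two points. -/
noncomputable def lineHom {ι : Type*} (x y : ι → K) : MvPolynomial ι K →ₐ[K] Polynomial K :=
  aeval fun p => Polynomial.C (x p) + Polynomial.C (y p - x p) * Polynomial.X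

lemma eval_lineHom {ι : Type*} (x y : ι → K) (t : K) (P : MvPolynomial ι K) :
    (lineHom x y P).eval t = eval (fun p => x p + (y p - x p) * t) P := by
  have : (Polynomial.aeval t).comp (lineHom x y) =
      aeval fun p => x p + (y p - x p) * t := by
    refine algHom_ext fun p => ?_
    simp [lineHom]
  rw [← aeval_eq_eval, ← this, AlgHom.comp_apply, Polynomial.coe_aeval_eq_eval]

/-- The set of graded automorphisms is irreducible. -/
lemma exists_eval_ne_zero [Infinite K] (hw : ∀ v, w v ≠ 0) {P Q : MvPolynomial (σ × (σ →₀ ℕ)) K}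
    (φ₁ φ₂ : GradedAut K w) (hP : eval (coords φ₁) P ≠ 0) (hQ : eval (coords φ₂) Q ≠ 0) :
    ∃ φ : GradedAut K w, eval (coords φ) P ≠ 0 ∧ eval (coords φ) Q ≠ 0 := by
  have := Fintype.ofFinite σ
  let L := lineHom (coords φ₁) (coords φ₂)
  have hL0 : ∀ P, (L P).eval 0 = eval (coords φ₁) P := fun P => by simp [L, eval_lineHom]
  have hL1 : ∀ P, (L P).eval 1 = eval (coords φ₂) P := fun P => by simp [L, eval_lineHom]
  have h1 : L P ≠ 0 := fun h => hP (by rw [← hL0, h, Polynomial.eval_zero])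
  have h2 : L Q ≠ 0 := fun h => hQ (by rw [← hL1, h, Polynomial.eval_zero])
  -- Off the zeros of this polynomial in `t`, the point on the line is again an automorphism.
  have h3 : ∏ v, L (degDet K hw (w v)) ≠ 0 := Finset.prod_ne_zero_iff.2 fun v _ h =>
    eval_coords_degDet_ne_zero hw φ₁ (w v) (by rw [← hL0, h, Polynomial.eval_zero])
  obtain ⟨t, ht⟩ := Polynomial.exists_eval_ne_zero_of_natDegree_lt_card _
    (mul_ne_zero (mul_ne_zero h1 h2) h3) (lt_of_lt_of_le (Cardinal.natCast_lt_aleph0)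
      (Cardinal.aleph0_le_mk K))
  simp only [Polynomial.eval_mul, Polynomial.eval_prod] at ht
  have ht1 := left_ne_zero_of_mul ht
  have ht3 := Finset.prod_ne_zero_iff.1 (right_ne_zero_of_mul ht)
  simp only [L, eval_lineHom] at ht1 ht3
  obtain ⟨φ, hφ⟩ := exists_gradedAut hw _ (fun v => ht3 v (Finset.mem_univ v)) fun v a h => by
    rw [coords_eq_zero φ₁ v a h, coords_eq_zero φ₂ v a h]
    simp
  rw [← hφ] at ht1
  exact ⟨φ, left_ne_zero_of_mul ht1, right_ne_zero_of_mul ht1⟩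

lemma IsZariskiOpen.inter_nonempty [Infinite K] (hw : ∀ v, w v ≠ 0) {U V : Set (GradedAut K w)}
    (hU : IsZariskiOpen U) (hV : IsZariskiOpen V) (hU' : U.Nonempty) (hV' : V.Nonempty) :
    (U ∩ V).Nonempty := by
  obtain ⟨S, rfl⟩ := hU
  obtain ⟨S', rfl⟩ := hV
  obtain ⟨φ₁, P, hP, hP0⟩ := hU'
  obtain ⟨φ₂, Q, hQ, hQ0⟩ := hV'
  obtain ⟨φ, h1, h2⟩ := exists_eval_ne_zero hw φ₁ φ₂ hP0 hQ0
  exact ⟨φ, ⟨P, hP, h1⟩, ⟨Q, hQ, h2⟩⟩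

lemma isZariskiOpen_biInter [Infinite K] (hw : ∀ v, w v ≠ 0) {ι : Type*} (s : Finset ι)
    (U : ι → Set (GradedAut K w)) (hU : ∀ i ∈ s, IsZariskiOpen (U i) ∧ (U i).Nonempty) :
    IsZariskiOpen {φ | ∀ i ∈ s, φ ∈ U i} ∧ {φ | ∀ i ∈ s, φ ∈ U i}.Nonempty := by
  classical
  induction s using Finset.induction_on with
  | empty => exact ⟨⟨{1}, by simp⟩, ⟨⟨AlgEquiv.refl, fun _ _ h => h⟩, by simp⟩⟩
  | insert a s ha ih =>
    obtain ⟨h1, h2⟩ := ih fun i hi => hU i (Finset.mem_insert_of_mem hi)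
    obtain ⟨h3, h4⟩ := hU a (Finset.mem_insert_self a s)
    have : {φ | ∀ i ∈ insert a s, φ ∈ U i} = U a ∩ {φ | ∀ i ∈ s, φ ∈ U i} := by
      ext φ; simp
    rw [this]
    exact ⟨h3.inter h1, h3.inter_nonempty hw h1 h4 h2⟩

/-! ### Lower semicontinuity of the rank of `φ(I)`. -/

/-- The rank of `φ(I)` on a set of coordinates. -/
noncomputable def autRank (I : Ideal (MvPolynomial σ K)) (S : Finset (σ →₀ ℕ))
    (φ : GradedAut K w) : ℕ :=
  rankOn S ((I.map φ.1).restrictScalars K)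

lemma restrictScalars_map_eq {σ : Type*} (I : Ideal (MvPolynomial σ K))
    (φ : MvPolynomial σ K ≃ₐ[K] MvPolynomial σ K) :
    (I.map φ).restrictScalars K = (I.restrictScalars K).map φ.toLinearMap := by
  ext f
  exact Ideal.mem_map_of_equiv φ f

lemma isZariskiOpen_le_autRank (hw : ∀ v, w v ≠ 0) (I : Ideal (MvPolynomial σ K))
    (S : Finset (σ →₀ ℕ)) (k : ℕ) :
    IsZariskiOpen {φ : GradedAut K w | k ≤ autRank I S φ} := by
  have key : ∀ (φ : GradedAut K w) (k : ℕ) (f : Fin k → MvPolynomial σ K)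
      (G : (S → K) →ₗ[K] (Fin k → K)),
      eval (coords φ) (Matrix.of fun i j => ∑ c : S,
        coeff c.1 (genericHom hw (f j)) * C (G (Pi.single c 1) i)).det =
      (Matrix.of fun i j => G (coeffOn S (φ.1 (f j))) i).det := by
    intro φ k f G
    rw [RingHom.map_det]
    congr 1
    ext i j
    simp only [RingHom.mapMatrix_apply, Matrix.map_apply, Matrix.of_apply, map_sum, map_mul,
      eval_coeff_genericHom, eval_C, specialHom_coords]
    rw [LinearMap.pi_apply_eq_sum_univ G, Finset.sum_apply]
    refine Finset.sum_congr rfl fun c _ => ?_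
    rw [Pi.smul_apply, smul_eq_mul, coeffOn_apply]
    have hc : (Pi.single c 1 : S → K) = fun j => if c = j then 1 else 0 := by
      ext c'
      simp [Pi.single_apply, eq_comm]
    rw [hc]
  -- The defining polynomials are the generalized minors of size at least `k`, with columns the
  -- generic images of elements of `I` and rows combined by `G`.
  refine ⟨{P | ∃ (k' : ℕ) (f : Fin k' → MvPolynomial σ K) (G : (S → K) →ₗ[K] (Fin k' → K)),
    k ≤ k' ∧ (∀ j, f j ∈ I) ∧ P = (Matrix.of fun i j => ∑ c : S,
        coeff c.1 (genericHom hw (f j)) * C (G (Pi.single c 1) i)).det}, ?_⟩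
  ext φ
  constructor
  · intro h
    have hspan : (I.map φ.1).restrictScalars K = Submodule.span K (φ.1 '' I) := by
      rw [restrictScalars_map_eq, ← Submodule.span_eq ((I.restrictScalars K).map φ.1.toLinearMap)]
      rfl
    have h' : k ≤ rankOn S (Submodule.span K (φ.1 '' (I : Set (MvPolynomial σ K)))) := by
      rw [← hspan]; exact h
    obtain ⟨g, G, hg, hdet⟩ := exists_det_ne_zero S (φ.1 '' (I : Set (MvPolynomial σ K)))
    choose f hf hfg using hg
    refine ⟨_, ⟨_, f, G, h', hf, rfl⟩, ?_⟩
    rw [key]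
    simpa only [hfg] using hdet
  · rintro ⟨_, ⟨k', f, G, hk, hf, rfl⟩, h⟩
    rw [key] at h
    exact hk.trans (le_rankOn_of_det_ne_zero (fun j => Ideal.mem_map_of_mem φ.1 (hf j)) G h)

end Generic

/-! ### Existence and uniqueness of the generic initial ideal. -/

section Existence

variable {σ K : Type*} [Field K]

/-- The exponents of the leading terms of the nonzero elements of `I`. -/
def leadExp (m : MonomialOrder σ) (I : Ideal (MvPolynomial σ K)) : Set (σ →₀ ℕ) :=
  {c | ∃ f ∈ I, f ≠ 0 ∧ m.degree f = c}

lemma mem_leadExp_of_le {m : MonomialOrder σ} {I : Ideal (MvPolynomial σ K)} {a b : σ →₀ ℕ}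
    (ha : a ∈ leadExp m I) (hab : a ≤ b) : b ∈ leadExp m I := by
  obtain ⟨f, hf, hf0, rfl⟩ := ha
  have h1 : (monomial (b - m.degree f) (1 : K)) ≠ 0 := by simp
  refine ⟨monomial (b - m.degree f) 1 * f, I.mul_mem_left _ hf, mul_ne_zero h1 hf0, ?_⟩
  rw [m.degree_mul h1 hf0, m.degree_monomial, if_neg one_ne_zero, tsub_add_cancel_of_le hab]

lemma mem_initialIdeal {m : MonomialOrder σ} {I : Ideal (MvPolynomial σ K)}
    {f : MvPolynomial σ K} :
    f ∈ initialIdeal m I ↔ ∀ c ∈ f.support, c ∈ leadExp m I := by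
  have h : initialIdeal m I = Ideal.span ((fun s => monomial s (1 : K)) '' leadExp m I) := by
    apply le_antisymm
    · refine Ideal.span_le.2 ?_
      rintro _ ⟨g, hg, rfl⟩
      by_cases hg0 : g = 0
      · simp [hg0]
      · rw [MonomialOrder.leadingTerm, ← mul_one (m.leadingCoeff g), ← C_mul_monomial]
        exact Ideal.mul_mem_left _ _ (Ideal.subset_span ⟨_, ⟨g, hg, hg0, rfl⟩, rfl⟩)
    · refine Ideal.span_le.2 ?_
      rintro _ ⟨_, ⟨g, hg, hg0, rfl⟩, rfl⟩
      have h0 := m.leadingCoeff_ne_zero_iff.2 hg0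
      have : monomial (m.degree g) (1 : K) = C (m.leadingCoeff g)⁻¹ * m.leadingTerm g := by
        rw [MonomialOrder.leadingTerm, C_mul_monomial, inv_mul_cancel₀ h0]
      rw [SetLike.mem_coe]
      change monomial (m.degree g) (1 : K) ∈ _
      rw [this]
      exact Ideal.mul_mem_left _ _ (Ideal.subset_span ⟨g, hg, rfl⟩)
  rw [h, mem_ideal_span_monomial_image]
  refine forall₂_congr fun c _ => ⟨?_, fun hc => ⟨c, hc, le_rfl⟩⟩
  rintro ⟨a, ha, hac⟩
  exact mem_leadExp_of_le ha hac

/-- `I` contains the homogeneous components of its elements. -/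
def HasComponents (w : σ → ℕ) (I : Ideal (MvPolynomial σ K)) : Prop :=
  ∀ d, ∀ f ∈ I, weightedHomogeneousComponent w d f ∈ I

/-- `S` consists of the exponents of weight `d` above some bound. -/
def IsUpperIn (m : MonomialOrder σ) (w : σ → ℕ) (d : ℕ) (S : Finset (σ →₀ ℕ)) : Prop :=
  (∀ c ∈ S, Finsupp.weight w c = d) ∧
    ∀ c ∈ S, ∀ c', Finsupp.weight w c' = d → c ≺[m] c' → c' ∈ S

/-- If `f` vanishes on the part of `S` above `c` but not at `c`, its component of weight `d` has
leading exponent `c`, since `S` contains every larger exponent of that weight. -/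
lemma rankOn_eq_card_leadExp {m : MonomialOrder σ} {w : σ → ℕ} {d : ℕ} {S : Finset (σ →₀ ℕ)}
    (hS : IsUpperIn m w d S) {I : Ideal (MvPolynomial σ K)} (hI : HasComponents w I) :
    rankOn S (I.restrictScalars K) = (S.filter (· ∈ leadExp m I)).card := by
  rw [rankOn_eq_card_filter m]
  congr 1
  refine Finset.filter_congr fun c hc => ⟨?_, ?_⟩
  · rintro ⟨f, hf, hfc, hfS⟩
    have hgc : coeff c (weightedHomogeneousComponent w d f) ≠ 0 := by
      rwa [coeff_weightedHomogeneousComponent, if_pos (hS.1 c hc)]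
    refine ⟨weightedHomogeneousComponent w d f, hI d f hf, ne_zero_iff.2 ⟨c, hgc⟩, ?_⟩
    apply m.toSyn.injective
    refine le_antisymm (m.degree_le_iff.2 fun b hb => ?_) (m.le_degree (mem_support_iff.2 hgc))
    rw [mem_support_iff, coeff_weightedHomogeneousComponent] at hb
    have hbd : Finsupp.weight w b = d := by
      by_contra h
      exact hb (if_neg h)
    rw [if_pos hbd] at hb
    by_contra hcb
    rw [not_le] at hcb
    exact hb (hfS b (hS.2 c hc b hbd hcb) hcb)
  · rintro ⟨f, hf, hf0, rfl⟩
    exact ⟨f, hf, m.coeff_degree_ne_zero_iff.2 hf0, fun c' _ h => m.coeff_eq_zero_of_lt h⟩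

lemma component_map {w : σ → ℕ} (φ : GradedAut K w) (d : ℕ) (f : MvPolynomial σ K) :
    weightedHomogeneousComponent w d (φ.1 f) = φ.1 (weightedHomogeneousComponent w d f) := by
  induction f using MvPolynomial.induction_on' with
  | monomial a r =>
    have h1 : IsWeightedHomogeneous w (monomial a r) (Finsupp.weight w a) :=
      isWeightedHomogeneous_monomial w a r rfl
    rw [weightedHomogeneousComponent_of_mem (h1 : _ ∈ weightedHomogeneousSubmodule K w _),
      weightedHomogeneousComponent_of_mem (φ.2 _ _ h1 : _ ∈ weightedHomogeneousSubmodule K w _)]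
    split_ifs
    · rfl
    · rw [map_zero]
  | add p q hp hq => simp only [map_add, hp, hq]

lemma HasComponents.map {w : σ → ℕ} {I : Ideal (MvPolynomial σ K)} (hI : HasComponents w I)
    (φ : GradedAut K w) : HasComponents w (I.map φ.1) := by
  intro d f hf
  obtain ⟨g, hg, rfl⟩ := (Ideal.mem_map_of_equiv φ.1 f).1 hf
  rw [component_map]
  exact Ideal.mem_map_of_mem φ.1 (hI d g hg)

lemma finrank_map_eq_of_ker {M N N' : Type*} [AddCommGroup M] [Module K M] [AddCommGroup N]
    [Module K N] [AddCommGroup N'] [Module K N'] (W : Submodule K M) (g : M →ₗ[K] N)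
    (h : M →ₗ[K] N') (hgh : ∀ x ∈ W, g x = 0 ↔ h x = 0) :
    Module.finrank K (W.map g) = Module.finrank K (W.map h) := by
  have hker : LinearMap.ker (g.domRestrict W) = LinearMap.ker (h.domRestrict W) := by
    ext x
    exact hgh x.1 x.2
  rw [← LinearMap.range_domRestrict, ← LinearMap.range_domRestrict,
    ← (g.domRestrict W).quotKerEquivRange.finrank_eq,
    ← (h.domRestrict W).quotKerEquivRange.finrank_eq, hker]

/-- The maximal rank of `φ(I)` on a set of coordinates. -/
noncomputable def maxRank (w : σ → ℕ) (I : Ideal (MvPolynomial σ K)) (S : Finset (σ →₀ ℕ)) : ℕ :=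
  sSup (Set.range (autRank (w := w) I S))

lemma bddAbove_autRank {w : σ → ℕ} (I : Ideal (MvPolynomial σ K)) (S : Finset (σ →₀ ℕ)) :
    BddAbove (Set.range (autRank (w := w) I S)) :=
  ⟨S.card, by rintro _ ⟨φ, rfl⟩; exact rankOn_le_card _ _⟩

lemma autRank_le_maxRank {w : σ → ℕ} (I : Ideal (MvPolynomial σ K)) (S : Finset (σ →₀ ℕ))
    (φ : GradedAut K w) : autRank I S φ ≤ maxRank w I S :=
  le_csSup (bddAbove_autRank I S) ⟨φ, rfl⟩

lemma exists_autRank_eq_maxRank {w : σ → ℕ} (I : Ideal (MvPolynomial σ K)) (S : Finset (σ →₀ ℕ)) :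
    ∃ φ : GradedAut K w, autRank I S φ = maxRank w I S := by
  have : Nonempty (GradedAut K w) := ⟨⟨AlgEquiv.refl, fun _ _ h => h⟩⟩
  exact Nat.sSup_mem (Set.range_nonempty _) (bddAbove_autRank I S)

variable [Finite σ] {w : σ → ℕ} (hw : ∀ v, w v ≠ 0)

lemma coeffOn_expo_eq_zero {d : ℕ} {f : MvPolynomial σ K} :
    coeffOn (expo w hw d) f = 0 ↔ weightedHomogeneousComponent w d f = 0 := by
  constructor
  · intro h
    ext c
    rw [coeff_weightedHomogeneousComponent, coeff_zero]
    split_ifs with hc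
    · exact congrFun h ⟨c, (mem_expo hw).2 hc⟩
    · rfl
  · intro h
    funext ⟨c, hc⟩
    have := congrArg (coeff c) h
    rwa [coeff_weightedHomogeneousComponent, if_pos ((mem_expo hw).1 hc)] at this

/-- Graded automorphisms preserve Hilbert functions. -/
lemma autRank_expo (I : Ideal (MvPolynomial σ K)) (d : ℕ) (φ : GradedAut K w) :
    autRank I (expo w hw d) φ = rankOn (expo w hw d) (I.restrictScalars K) := by
  unfold autRank rankOn
  rw [restrictScalars_map_eq, ← Submodule.map_comp]
  refine finrank_map_eq_of_ker _ _ _ fun f _ => ?_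
  rw [LinearMap.comp_apply, AlgEquiv.toLinearMap_apply, coeffOn_expo_eq_zero,
    coeffOn_expo_eq_zero, component_map, map_eq_zero_iff _ φ.1.injective]

lemma isUpperIn_expo (m : MonomialOrder σ) (d : ℕ) : IsUpperIn m w d (expo w hw d) :=
  ⟨fun _ hc => (mem_expo hw).1 hc, fun _ _ _ hc' _ => (mem_expo hw).2 hc'⟩

/-- The exponents of the weight of `a` that are larger than `a`. -/
noncomputable def above (m : MonomialOrder σ) (a : σ →₀ ℕ) : Finset (σ →₀ ℕ) :=
  (expo w hw (Finsupp.weight w a)).filter fun c => a ≺[m] c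

lemma mem_above {m : MonomialOrder σ} {a c : σ →₀ ℕ} :
    c ∈ above hw m a ↔ Finsupp.weight w c = Finsupp.weight w a ∧ a ≺[m] c := by
  simp [above]

lemma isUpperIn_above (m : MonomialOrder σ) (a : σ →₀ ℕ) :
    IsUpperIn m w (Finsupp.weight w a) (above hw m a) := by
  refine ⟨fun c hc => ((mem_above hw).1 hc).1, fun c hc c' hc' hlt => ?_⟩
  exact (mem_above hw).2 ⟨hc', ((mem_above hw).1 hc).2.trans hlt⟩

lemma isUpperIn_insert_above (m : MonomialOrder σ) (a : σ →₀ ℕ) :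
    IsUpperIn m w (Finsupp.weight w a) (insert a (above hw m a)) := by
  refine ⟨fun c hc => ?_, fun c hc c' hc' hlt => ?_⟩
  · rcases Finset.mem_insert.1 hc with rfl | hc
    · rfl
    · exact ((mem_above hw).1 hc).1
  · rcases Finset.mem_insert.1 hc with rfl | hc
    · exact Finset.mem_insert_of_mem ((mem_above hw).2 ⟨hc', hlt⟩)
    · exact Finset.mem_insert_of_mem
        ((mem_above hw).2 ⟨hc', ((mem_above hw).1 hc).2.trans hlt⟩)

lemma isZariskiOpen_autRank_eq_maxRank (hw : ∀ v, w v ≠ 0) (I : Ideal (MvPolynomial σ K)) (S : Finset (σ →₀ ℕ)) :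
    IsZariskiOpen {φ : GradedAut K w | autRank I S φ = maxRank w I S} ∧
      {φ : GradedAut K w | autRank I S φ = maxRank w I S}.Nonempty := by
  refine ⟨?_, exists_autRank_eq_maxRank I S⟩
  convert isZariskiOpen_le_autRank hw I S (maxRank w I S) using 2
  ext φ
  exact ⟨fun h => h.ge, fun h => le_antisymm (autRank_le_maxRank I S φ) h⟩

/-- The exponents of the generic initial ideal. -/
def genExp (m : MonomialOrder σ) (I : Ideal (MvPolynomial σ K)) : Set (σ →₀ ℕ) :=
  {a | maxRank w I (insert a (above hw m a)) ≠ maxRank w I (above hw m a)}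

/-- Both sets are upper segments and differ only in `a`, so the rank jumps exactly when `a` is a
leading exponent. -/
lemma mem_leadExp_iff_mem_genExp {m : MonomialOrder σ} {I : Ideal (MvPolynomial σ K)}
    (hI : HasComponents w I) {a : σ →₀ ℕ} {φ : GradedAut K w}
    (h1 : autRank I (insert a (above hw m a)) φ = maxRank w I (insert a (above hw m a)))
    (h2 : autRank I (above hw m a) φ = maxRank w I (above hw m a)) :
    a ∈ leadExp m (I.map φ.1) ↔ a ∈ genExp hw m I := by
  have ha : a ∉ above hw m a := fun h => lt_irrefl _ ((mem_above hw).1 h).2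
  rw [genExp, Set.mem_ofPred_eq, ← h1, ← h2, autRank, autRank,
    rankOn_eq_card_leadExp (isUpperIn_insert_above hw m a) (hI.map φ),
    rankOn_eq_card_leadExp (isUpperIn_above hw m a) (hI.map φ), Finset.filter_insert]
  split_ifs with h
  · simp [h, ha]
  · simp [h]

lemma exists_isZariskiOpen_leadExp [Infinite K] (m : MonomialOrder σ)
    {I : Ideal (MvPolynomial σ K)} (hI : HasComponents w I) (B : Finset (σ →₀ ℕ)) :
    ∃ U : Set (GradedAut K w), IsZariskiOpen U ∧ U.Nonempty ∧
      ∀ φ ∈ U, ∀ a ∈ B, a ∈ leadExp m (I.map φ.1) ↔ a ∈ genExp hw m I := by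
  obtain ⟨h1, h2⟩ := isZariskiOpen_biInter hw B
    (fun a => {φ : GradedAut K w |
        autRank I (insert a (above hw m a)) φ = maxRank w I (insert a (above hw m a))} ∩
      {φ : GradedAut K w | autRank I (above hw m a) φ = maxRank w I (above hw m a)})
    fun a _ => by
      obtain ⟨h1, h2⟩ := isZariskiOpen_autRank_eq_maxRank hw I (insert a (above hw m a))
      obtain ⟨h3, h4⟩ := isZariskiOpen_autRank_eq_maxRank hw I (above hw m a)
      exact ⟨h1.inter h3, h1.inter_nonempty hw h3 h2 h4⟩
  exact ⟨_, h1, h2, fun φ hφ a ha => mem_leadExp_iff_mem_genExp hw hI (hφ a ha).1 (hφ a ha).2⟩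

/-- Existence of the generic initial ideal. -/
lemma exists_isGin [Infinite K] (hw : ∀ v, w v ≠ 0) (m : MonomialOrder σ) {I : Ideal (MvPolynomial σ K)}
    (hI : HasComponents w I) : ∃ J, IsGin m w I J := by
  -- A finite set of generators is what keeps the intersection of open conditions finite.
  obtain ⟨B₀, hB, hspan⟩ := (Submodule.fg_span_iff_fg_span_finset_subset (R := MvPolynomial σ K)
    ((fun s => monomial s (1 : K)) '' genExp hw m I)).1 (IsNoetherian.noetherian _)
  obtain ⟨B, hBM, rfl⟩ := Finset.subset_set_image_iff.1 hB
  have hgen : ∀ c ∈ genExp hw m I, ∃ b ∈ B, b ≤ c := by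
    intro c hc
    have h1 : monomial c (1 : K) ∈ Ideal.span ((fun s => monomial s (1 : K)) '' (B : Set _)) := by
      have : monomial c (1 : K) ∈ Ideal.span ((fun s => monomial s (1 : K)) '' genExp hw m I) :=
        Ideal.subset_span ⟨c, hc, rfl⟩
      rw [Finset.coe_image] at hspan
      exact hspan.le this
    simpa using mem_ideal_span_monomial_image.1 h1 c (by simp)
  obtain ⟨U, hU, ⟨φ₀, hφ₀⟩, hUB⟩ := exists_isZariskiOpen_leadExp hw m hI B
  have hsub : ∀ φ ∈ U, genExp hw m I ⊆ leadExp m (I.map φ.1) := by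
    intro φ hφ c hc
    obtain ⟨b, hb, hbc⟩ := hgen c hc
    exact mem_leadExp_of_le ((hUB φ hφ b hb).2 (hBM hb)) hbc
  have heq : ∀ φ ∈ U, leadExp m (I.map φ.1) = genExp hw m I := by
    intro φ hφ
    refine Set.Subset.antisymm (fun c hc => ?_) (hsub φ hφ)
    let E := expo w hw (Finsupp.weight w c)
    -- An auxiliary `ψ`, generic for this one weight, counts the candidate exponents; `φ` and `ψ`
    -- give the same count by the Hilbert function.
    obtain ⟨V, -, ⟨ψ, hψ⟩, hVE⟩ := exists_isZariskiOpen_leadExp hw m hI E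
    have hcard : (E.filter (· ∈ leadExp m (I.map φ.1))).card =
        (E.filter (· ∈ genExp hw m I)).card := by
      have h1 : E.filter (· ∈ genExp hw m I) = E.filter (· ∈ leadExp m (I.map ψ.1)) :=
        Finset.filter_congr fun a ha => (hVE ψ hψ a ha).symm
      rw [h1, ← rankOn_eq_card_leadExp (isUpperIn_expo hw m _) (hI.map φ),
        ← rankOn_eq_card_leadExp (isUpperIn_expo hw m _) (hI.map ψ)]
      exact (autRank_expo hw I _ φ).trans (autRank_expo hw I _ ψ).symm
    have hE : E.filter (· ∈ genExp hw m I) = E.filter (· ∈ leadExp m (I.map φ.1)) :=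
      Finset.eq_of_subset_of_card_le
        (Finset.monotone_filter_right _ fun a _ ha => hsub φ hφ ha) hcard.le
    have hcE : c ∈ E.filter (· ∈ leadExp m (I.map φ.1)) :=
      Finset.mem_filter.2 ⟨(mem_expo hw).2 rfl, hc⟩
    rw [← hE] at hcE
    exact (Finset.mem_filter.1 hcE).2
  refine ⟨initialIdeal m (I.map φ₀.1), U, hU, ⟨φ₀, hφ₀⟩, fun φ hφ => ?_⟩
  ext f
  rw [mem_initialIdeal, mem_initialIdeal, heq φ hφ, heq φ₀ hφ₀]

lemma IsGin.unique [Infinite K] (hw : ∀ v, w v ≠ 0) {m : MonomialOrder σ}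
    {I J J' : Ideal (MvPolynomial σ K)} (hJ : IsGin m w I J) (hJ' : IsGin m w I J') : J = J' := by
  obtain ⟨U, hU, hU', h⟩ := hJ
  obtain ⟨V, hV, hV', h'⟩ := hJ'
  obtain ⟨φ, hφU, hφV⟩ := hU.inter_nonempty hw hV hU' hV'
  exact (h φ hφU).symm.trans (h' φ hφV)

end Existence

/-! ### Degeneration to the initial ideal by rescaling the variables. -/

section Torus

variable {σ K : Type*} [Field K]

lemma coeff_prod_of_degree_le {R ι : Type*} [CommSemiring R] (m : MonomialOrder σ) (s : Finset ι)
    (P : ι → MvPolynomial σ R) (c : ι → σ →₀ ℕ) (h : ∀ i ∈ s, m.degree (P i) ≼[m] c i) :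
    coeff (∑ i ∈ s, c i) (∏ i ∈ s, P i) = ∏ i ∈ s, coeff (c i) (P i) := by
  induction s using Finset.induction_on with
  | empty => simp
  | insert a s has ih =>
    have h' : ∀ i ∈ s, m.degree (P i) ≼[m] c i := fun i hi => h i (Finset.mem_insert_of_mem hi)
    rw [Finset.prod_insert has, Finset.sum_insert has, Finset.prod_insert has, ← ih h']
    refine m.coeff_mul_of_add_of_degree_le (h a (Finset.mem_insert_self a s)) ?_
    refine m.degree_prod_le.trans ?_
    rw [map_sum, map_sum]
    exact Finset.sum_le_sum h'

/-- The degree bound depends only on the column, so each Leibniz term has the same extremal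
exponent. -/
lemma coeff_det_of_degree_le {k : ℕ} (m : MonomialOrder σ)
    (E : Matrix (Fin k) (Fin k) (MvPolynomial σ K)) (c : Fin k → σ →₀ ℕ)
    (h : ∀ i j, m.degree (E i j) ≼[m] c j) :
    coeff (∑ j, c j) E.det = (Matrix.of fun i j => coeff (c j) (E i j)).det := by
  rw [Matrix.det_apply, Matrix.det_apply, coeff_sum]
  refine Finset.sum_congr rfl fun π _ => ?_
  rw [coeff_smul, (coeff_prod_of_degree_le m Finset.univ (fun i => E (π i) i) c
    fun i _ => h (π i) i)]
  rfl

/-- The automorphism that rescales the variables. -/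
noncomputable def scale (u : σ → Kˣ) : MvPolynomial σ K ≃ₐ[K] MvPolynomial σ K :=
  AlgEquiv.ofAlgHom (aeval fun v => (u v : K) • X v)
    (aeval fun v => (((u v)⁻¹ : Kˣ) : K) • X v)
    (algHom_ext fun v => by simp [smul_smul])
    (algHom_ext fun v => by simp [smul_smul])

lemma scale_monomial (u : σ → Kˣ) (a : σ →₀ ℕ) (r : K) :
    scale u (monomial a r) = eval (fun v => (u v : K)) (monomial a 1) • monomial a r := by
  change aeval _ _ = _
  rw [aeval_monomial, eval_monomial, one_mul, monomial_eq, algebraMap_eq, smul_eq_C_mul]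
  simp only [Finsupp.prod, smul_eq_C_mul, mul_pow, Finset.prod_mul_distrib, map_prod, map_pow]
  ring

lemma isWeightedHomogeneous_scale {w : σ → ℕ} (u : σ → Kˣ) (d : ℕ) (f : MvPolynomial σ K)
    (hf : IsWeightedHomogeneous w f d) : IsWeightedHomogeneous w (scale u f) d := by
  refine isWeightedHomogeneous_algHom (scale u).toAlgHom (fun v => ?_) hf
  change IsWeightedHomogeneous w (scale u (X v)) (w v)
  rw [X, scale_monomial, smul_eq_C_mul]
  exact (isWeightedHomogeneous_X K w v).C_mul _

/-- The values of the functional `ℓ` on the rescalings of `f`, as a polynomial in the scale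
factors. -/
noncomputable def twist (ℓ : MvPolynomial σ K →ₗ[K] K) (f : MvPolynomial σ K) :
    MvPolynomial σ K :=
  ∑ b ∈ f.support, monomial b (coeff b f * ℓ (monomial b 1))

lemma coeff_twist (ℓ : MvPolynomial σ K →ₗ[K] K) (f : MvPolynomial σ K) (b : σ →₀ ℕ) :
    coeff b (twist ℓ f) = coeff b f * ℓ (monomial b 1) := by
  rw [twist, coeff_sum]
  simp only [coeff_monomial, Finset.sum_ite_eq', mem_support_iff]
  split_ifs with h
  · rfl
  · rw [not_not.1 h, zero_mul]

lemma eval_twist (ℓ : MvPolynomial σ K →ₗ[K] K) (f : MvPolynomial σ K) (u : σ → Kˣ) :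
    eval (fun v => (u v : K)) (twist ℓ f) = ℓ (scale u f) := by
  conv_rhs => rw [f.as_sum]
  rw [twist, map_sum, map_sum, map_sum]
  refine Finset.sum_congr rfl fun b _ => ?_
  have : monomial b (coeff b f) = coeff b f • monomial b (1 : K) := by
    rw [smul_monomial, smul_eq_mul, mul_one]
  rw [scale_monomial, map_smul, this, map_smul, eval_monomial, eval_monomial]
  simp only [smul_eq_mul]
  ring

lemma degree_twist_le (m : MonomialOrder σ) (ℓ : MvPolynomial σ K →ₗ[K] K)
    (f : MvPolynomial σ K) : m.degree (twist ℓ f) ≼[m] m.degree f := by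
  refine m.degree_le_iff.2 fun b hb => m.le_degree ?_
  rw [mem_support_iff, coeff_twist] at hb
  exact mem_support_iff.2 (left_ne_zero_of_mul hb)

lemma restrictScalars_initialIdeal (m : MonomialOrder σ) (I : Ideal (MvPolynomial σ K)) :
    (initialIdeal m I).restrictScalars K =
      Submodule.span K ((fun c => monomial c (1 : K)) '' leadExp m I) := by
  apply le_antisymm
  · intro f hf
    have hf' : f ∈ initialIdeal m I := hf
    rw [mem_initialIdeal] at hf'
    rw [f.as_sum]
    refine Submodule.sum_mem _ fun c hc => ?_
    have : monomial c (coeff c f) = coeff c f • monomial c (1 : K) := by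
      rw [smul_monomial, smul_eq_mul, mul_one]
    rw [this]
    exact Submodule.smul_mem _ _ (Submodule.subset_span ⟨c, hf' c hc, rfl⟩)
  · refine Submodule.span_le.2 ?_
    rintro _ ⟨c, hc, rfl⟩
    change monomial c (1 : K) ∈ initialIdeal m I
    refine mem_initialIdeal.2 fun b hb => ?_
    rw [support_monomial, if_neg one_ne_zero, Finset.mem_singleton] at hb
    rwa [hb]

/-- The composition of graded automorphisms. -/
noncomputable def GradedAut.comp {w : σ → ℕ} (φ ψ : GradedAut K w) : GradedAut K w :=
  ⟨ψ.1.trans φ.1, fun d f hf => φ.2 d _ (ψ.2 d f hf)⟩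

/-- Passing to the initial ideal does not increase the generic rank. -/
lemma exists_rankOn_map_initialIdeal_le [Infinite K] [Finite σ] (m : MonomialOrder σ)
    {w : σ → ℕ} (I : Ideal (MvPolynomial σ K)) (S : Finset (σ →₀ ℕ)) (τ : GradedAut K w) :
    ∃ φ : GradedAut K w, autRank (initialIdeal m I) S τ ≤ autRank I S φ := by
  have := Fintype.ofFinite σ
  let X₀ := τ.1 '' ((fun c => monomial c (1 : K)) '' leadExp m I)
  have hX : ((initialIdeal m I).map τ.1).restrictScalars K = Submodule.span K X₀ := by
    rw [restrictScalars_map_eq, restrictScalars_initialIdeal, Submodule.map_span]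
    rfl
  unfold autRank
  rw [hX]
  obtain ⟨g, G, hg, hdet⟩ := exists_det_ne_zero S X₀
  have hg' : ∀ j, ∃ f ∈ I, f ≠ 0 ∧ τ.1 (monomial (m.degree f) (1 : K)) = g j := by
    intro j
    obtain ⟨_, ⟨_, ⟨f, hf, hf0, rfl⟩, rfl⟩, h⟩ := hg j
    exact ⟨f, hf, hf0, h⟩
  choose f hfI hf0 hfg using hg'
  let ℓ := fun i => LinearMap.proj i ∘ₗ G ∘ₗ coeffOn S ∘ₗ τ.1.toLinearMap
  have hℓ : ∀ i h, ℓ i h = G (coeffOn S (τ.1 h)) i := fun _ _ => rfl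
  let E : Matrix _ _ (MvPolynomial σ K) := Matrix.of fun i j => twist (ℓ i) (f j)
  -- The coefficient of the determinant at the sum of the leading exponents is the product of the
  -- leading coefficients times the nonzero minor of the images of the leading monomials.
  have hE : E.det ≠ 0 := by
    intro h0
    have h1 := coeff_det_of_degree_le m E (fun j => m.degree (f j))
      fun i j => degree_twist_le m (ℓ i) (f j)
    have h2 : (Matrix.of fun i j => coeff (m.degree (f j)) (E i j)) =
        Matrix.of fun i j => m.leadingCoeff (f j) *
          (Matrix.of fun i j => G (coeffOn S (g j)) i) i j := by
      ext i j
      simp only [E, Matrix.of_apply, coeff_twist, hℓ, hfg]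
      rfl
    rw [h0, coeff_zero, h2, Matrix.det_mul_row] at h1
    exact mul_ne_zero (Finset.prod_ne_zero_iff.2 fun j _ => m.leadingCoeff_ne_zero_iff.2 (hf0 j))
      hdet h1.symm
  -- The extra factor forces all scale factors to be invertible.
  have hprod : E.det * ∏ v, X v ≠ 0 :=
    mul_ne_zero hE (Finset.prod_ne_zero_iff.2 fun v _ => X_ne_zero v)
  obtain ⟨x, hx⟩ : ∃ x : σ → K, eval x (E.det * ∏ v, X v) ≠ 0 := by
    by_contra! h
    exact hprod (MvPolynomial.funext fun x => by rw [h x, map_zero])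
  rw [map_mul, map_prod] at hx
  have hxv := Finset.prod_ne_zero_iff.1 (right_ne_zero_of_mul hx)
  simp only [eval_X, Finset.mem_univ, true_implies] at hxv
  let u : σ → Kˣ := fun v => Units.mk0 (x v) (hxv v)
  refine ⟨GradedAut.comp τ ⟨scale u, isWeightedHomogeneous_scale u⟩, ?_⟩
  refine le_rankOn_of_det_ne_zero (f := fun j => τ.1 (scale u (f j)))
    (fun j => Ideal.mem_map_of_mem (GradedAut.comp τ ⟨scale u, _⟩).1 (hfI j)) G ?_
  have h3 := left_ne_zero_of_mul hx
  rw [RingHom.map_det] at h3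
  convert h3 using 2
  ext i j
  exact (eval_twist (ℓ i) (f j) u).symm

end Torus

/-! ### Invariance under upper triangular automorphisms. -/

section Fixed

variable {σ K : Type*} [Field K]

/-- Raising variables suffices because the term order is compatible with products. -/
lemma le_of_coeff_map_monomial_ne_zero (m : MonomialOrder σ)
    (τ : MvPolynomial σ K ≃ₐ[K] MvPolynomial σ K)
    (hτ : ∀ v e, coeff e (τ (X v)) ≠ 0 → Finsupp.single v 1 ≼[m] e) (c : σ →₀ ℕ) :
    ∀ e, coeff e (τ (monomial c 1)) ≠ 0 → c ≼[m] e := by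
  have hadd : ∀ c d : σ →₀ ℕ, (∀ e, coeff e (τ (monomial c 1)) ≠ 0 → c ≼[m] e) →
      (∀ e, coeff e (τ (monomial d 1)) ≠ 0 → d ≼[m] e) →
      ∀ e, coeff e (τ (monomial (c + d) 1)) ≠ 0 → c + d ≼[m] e := by
    intro c d hc hd e he
    have h1 : monomial (c + d) (1 : K) = monomial c 1 * monomial d 1 := by
      rw [monomial_mul, one_mul]
    rw [h1, map_mul, coeff_mul] at he
    obtain ⟨⟨a, b⟩, hab, h⟩ := Finset.exists_ne_zero_of_sum_ne_zero he
    rw [← Finset.HasAntidiagonal.mem_antidiagonal.1 hab, map_add, map_add]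
    exact add_le_add (hc a (left_ne_zero_of_mul h)) (hd b (right_ne_zero_of_mul h))
  induction c using Finsupp.induction_linear with
  | zero => intro e _; simp
  | add c d hc hd => exact hadd c d hc hd
  | single v n =>
    induction n with
    | zero => intro e _; simp
    | succ n ih =>
      rw [Finsupp.single_add]
      exact hadd _ _ ih fun e he => hτ v e he

variable [Infinite K] [Finite σ] {w : σ → ℕ} (hw : ∀ v, w v ≠ 0)

/-- An automorphism that raises monomials maps the leading monomials into an initial ideal on
which the ranks of `φ₀(I)` are maximal. -/
lemma map_monomial_mem_initialIdeal {m : MonomialOrder σ} {I : Ideal (MvPolynomial σ K)}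
    (hI : HasComponents w I) (φ₀ : GradedAut K w) (c : σ →₀ ℕ)
    (hmax : autRank I (above hw m c) φ₀ = maxRank w I (above hw m c)) (τ : GradedAut K w)
    (hτ : ∀ c e, coeff e (τ.1 (monomial c 1)) ≠ 0 → c ≼[m] e)
    (hc : c ∈ leadExp m (I.map φ₀.1))
    (hgt : ∀ b ∈ above hw m c, b ∈ leadExp m (I.map φ₀.1) →
      τ.1 (monomial b 1) ∈ initialIdeal m (I.map φ₀.1)) :
    τ.1 (monomial c 1) ∈ initialIdeal m (I.map φ₀.1) := by
  set S := above hw m c with hS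
  set J := initialIdeal m (I.map φ₀.1) with hJ
  set M := leadExp m (I.map φ₀.1) with hM
  have hmonJ : ∀ {b}, b ∈ M → monomial b (1 : K) ∈ J := fun {b} hb => mem_initialIdeal.2
    fun a ha => by
      rw [support_monomial, if_neg one_ne_zero, Finset.mem_singleton] at ha
      rwa [ha]
  have hweight : ∀ b e, coeff e (τ.1 (monomial b (1 : K))) ≠ 0 →
      Finsupp.weight w e = Finsupp.weight w b := fun b e he =>
    τ.2 _ _ (isWeightedHomogeneous_monomial w b 1 rfl) he
  by_contra hbad
  obtain ⟨b, hb, hbM⟩ : ∃ b, coeff b (τ.1 (monomial c (1 : K))) ≠ 0 ∧ b ∉ M := by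
    by_contra! h
    exact hbad (mem_initialIdeal.2 fun b hb => h b (mem_support_iff.1 hb))
  have hbS : b ∈ S := (mem_above hw).2 ⟨hweight c b hb, lt_of_le_of_ne (hτ c b hb) fun h =>
    hbM (m.toSyn.injective h ▸ hc)⟩
  -- `N` is spanned by the monomials of `J` above `c`. By `hgt` it is mapped into itself by `τ`,
  -- hence onto itself by dimension.
  let N : Submodule K (MvPolynomial σ K) :=
    Submodule.span K ((fun c => monomial c (1 : K)) '' ((S.filter (· ∈ M) : Finset _) : Set _))
  have hNfin : FiniteDimensional K N :=
    FiniteDimensional.span_of_finite K ((Finset.finite_toSet _).image _)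
  have hNJ : N ≤ J.restrictScalars K := by
    refine Submodule.span_le.2 ?_
    rintro _ ⟨e, he, rfl⟩
    exact hmonJ (Finset.mem_filter.1 (Finset.mem_coe.1 he)).2
  have hτN : N.map τ.1.toLinearMap ≤ N := by
    rw [Submodule.map_span_le]
    rintro _ ⟨e, he, rfl⟩
    obtain ⟨heS, heM⟩ := Finset.mem_filter.1 (Finset.mem_coe.1 he)
    rw [AlgEquiv.toLinearMap_apply, (τ.1 (monomial e 1)).as_sum]
    refine Submodule.sum_mem _ fun a ha => ?_
    have : monomial a (coeff a (τ.1 (monomial e 1))) =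
        coeff a (τ.1 (monomial e 1)) • monomial a (1 : K) := by
      rw [smul_monomial, smul_eq_mul, mul_one]
    rw [this]
    refine Submodule.smul_mem _ _ (Submodule.subset_span ⟨a, ?_, rfl⟩)
    have ha' := mem_support_iff.1 ha
    have heS' := (mem_above hw).1 heS
    exact Finset.mem_coe.2 (Finset.mem_filter.2 ⟨(mem_above hw).2
      ⟨(hweight e a ha').trans heS'.1, heS'.2.trans_le (hτ e a ha')⟩,
      mem_initialIdeal.1 (hgt e heS heM) a ha⟩)
  have hτN' : N.map τ.1.toLinearMap = N :=
    Submodule.eq_of_le_of_finrank_eq hτN (LinearEquiv.finrank_map_eq τ.1.toLinearEquiv N)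
  have hle : (J.restrictScalars K).map (coeffOn S) ≤
      ((J.map τ.1).restrictScalars K).map (coeffOn S) := by
    conv_lhs => rw [hJ, restrictScalars_initialIdeal]
    rw [Submodule.map_span_le]
    rintro _ ⟨e, he, rfl⟩
    by_cases heS : e ∈ S
    · refine Submodule.mem_map_of_mem ?_
      have heN : monomial e (1 : K) ∈ N.map τ.1.toLinearMap := by
        rw [hτN']
        exact Submodule.subset_span ⟨e, Finset.mem_coe.2 (Finset.mem_filter.2 ⟨heS, he⟩), rfl⟩
      rw [restrictScalars_map_eq]
      exact Submodule.map_mono hNJ heN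
    · have : coeffOn S (monomial e (1 : K)) = 0 := by
        funext a
        rw [coeffOn_apply, coeff_monomial, if_neg (ne_of_mem_of_not_mem a.2 heS).symm]
        rfl
      rw [this]
      exact Submodule.zero_mem _
  -- The image of `c` adds a new vector: it has a nonzero coefficient at `b`, which lies in `S`,
  -- where all elements of `J` vanish.
  have hlt : (J.restrictScalars K).map (coeffOn S) <
      ((J.map τ.1).restrictScalars K).map (coeffOn S) := by
    refine lt_of_le_not_ge hle fun hge => ?_
    have h1 : τ.1 (monomial c (1 : K)) ∈ (J.map τ.1).restrictScalars K :=
      Ideal.mem_map_of_mem τ.1 (hmonJ hc)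
    obtain ⟨f, hf, hfe⟩ := hge (Submodule.mem_map_of_mem h1)
    have hfb : coeff b f = coeff b (τ.1 (monomial c 1)) := congrFun hfe ⟨b, hbS⟩
    exact hbM (mem_initialIdeal.1 (show f ∈ J from hf) b (mem_support_iff.2 (hfb ▸ hb)))
  have h1 : rankOn S (J.restrictScalars K) < autRank J S τ :=
    Submodule.finrank_lt_finrank_of_lt hlt
  obtain ⟨φ, h2⟩ := exists_rankOn_map_initialIdeal_le m (I.map φ₀.1) S τ
  rw [← hJ] at h2
  have h3 : autRank (I.map φ₀.1) S φ = autRank I S (φ.comp φ₀) := by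
    unfold autRank
    rw [restrictScalars_map_eq, restrictScalars_map_eq, restrictScalars_map_eq,
      ← Submodule.map_comp]
    rfl
  have h4 : autRank I S φ₀ = (S.filter (· ∈ M)).card :=
    rankOn_eq_card_leadExp (isUpperIn_above hw m c) (hI.map φ₀)
  have h5 : rankOn S (J.restrictScalars K) = (S.filter (· ∈ M)).card := by
    rw [rankOn_eq_card_filter m]
    congr 1
    refine Finset.filter_congr fun e _ => ⟨?_, fun he => ?_⟩
    · rintro ⟨f, hf, hfe, -⟩
      exact mem_initialIdeal.1 (show f ∈ J from hf) e (mem_support_iff.2 hfe)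
    · refine ⟨monomial e 1, hmonJ he, by simp, fun a _ ha => ?_⟩
      rw [coeff_monomial, if_neg]
      rintro rfl
      exact lt_irrefl _ ha
  have h6 := autRank_le_maxRank I S (φ.comp φ₀)
  omega

/-- The generic initial ideal is fixed by the automorphisms that raise monomials. -/
lemma IsGin.map_eq (hw : ∀ v, w v ≠ 0) {m : MonomialOrder σ} {I J : Ideal (MvPolynomial σ K)}
    (hI : HasComponents w I) (hJ : IsGin m w I J) (τ : GradedAut K w)
    (hτ : ∀ c e, coeff e (τ.1 (monomial c 1)) ≠ 0 → c ≼[m] e) : J.map τ.1 = J := by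
  obtain ⟨U, hU, hU', hUJ⟩ := hJ
  have key : ∀ c, monomial c (1 : K) ∈ J → τ.1 (monomial c (1 : K)) ∈ J := by
    -- Among the bad monomials of one weight, a largest one is chosen, so that all monomials of `J`
    -- above it are good.
    by_contra! h
    obtain ⟨c₀, hc₀, hc₀'⟩ := h
    obtain ⟨c, hc, hcmax⟩ := Finset.exists_max_image
      ((expo w hw (Finsupp.weight w c₀)).filter fun c =>
        monomial c (1 : K) ∈ J ∧ τ.1 (monomial c (1 : K)) ∉ J) m.toSyn
      ⟨c₀, Finset.mem_filter.2 ⟨(mem_expo hw).2 rfl, hc₀, hc₀'⟩⟩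
    obtain ⟨hcd, hcJ, hcτ⟩ := Finset.mem_filter.1 hc
    obtain ⟨hV, hV'⟩ := isZariskiOpen_autRank_eq_maxRank hw I (above hw m c)
    obtain ⟨φ₀, hφU, hφV⟩ := hU.inter_nonempty hw hV hU' hV'
    have hmem : ∀ b, b ∈ leadExp m (I.map φ₀.1) ↔ monomial b (1 : K) ∈ J := by
      intro b
      rw [← hUJ φ₀ hφU, mem_initialIdeal, support_monomial, if_neg one_ne_zero]
      simp
    refine hcτ ?_
    rw [← hUJ φ₀ hφU]
    refine map_monomial_mem_initialIdeal hw hI φ₀ c hφV τ hτ ((hmem c).2 hcJ) fun b hb hbM => ?_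
    rw [hUJ φ₀ hφU]
    by_contra hbτ
    obtain ⟨hbw, hcb⟩ := (mem_above hw).1 hb
    refine (hcmax b (Finset.mem_filter.2 ⟨(mem_expo hw).2 ?_, (hmem b).1 hbM, hbτ⟩)).not_gt hcb
    exact hbw.trans ((mem_expo hw).1 hcd)
  have hle : J ≤ J.comap τ.1.toRingEquiv.toRingHom := by
    obtain ⟨φ₀, hφ₀⟩ := hU'
    intro f hf
    have hf' := hf
    rw [← hUJ φ₀ hφ₀, mem_initialIdeal] at hf'
    change τ.1 f ∈ J
    rw [f.as_sum, map_sum]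
    refine J.sum_mem fun c hc => ?_
    have : monomial c (coeff c f) = coeff c f • monomial c (1 : K) := by
      rw [smul_monomial, smul_eq_mul, mul_one]
    rw [this, map_smul, smul_eq_C_mul]
    refine J.mul_mem_left _ (key c ?_)
    rw [← hUJ φ₀ hφ₀, mem_initialIdeal, support_monomial, if_neg one_ne_zero]
    simpa using hf' c hc
  refine le_antisymm (Ideal.map_le_iff_le_comap.2 hle) fun f hf => ?_
  obtain ⟨g, rfl⟩ := τ.1.surjective f
  exact Ideal.mem_map_of_mem τ.1
    (mem_of_map_mem_of_surjective τ.1.toRingEquiv.toRingHom τ.1.surjective hle hf)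

/-- Upper triangular automorphisms raise the variables. -/
lemma single_le_of_mem_upperTriangular {n : ℕ} {l q : Fin n → ℕ} (hq_pos : ∀ i, 0 < q i)
    (hq : StrictMono q) (m : MonomialOrder (Idx l))
    (h_lin : ∀ (i : Fin n) (j k : Fin (l i)), j < k →
      Finsupp.single (⟨i, k⟩ : Idx l) 1 ≺[m] Finsupp.single (⟨i, j⟩ : Idx l) 1)
    (h_nonlin : ∀ (i : Fin n) (j : Fin (l i)) (a : Idx l →₀ ℕ),
      Finsupp.weight (wt l q) a = q i → (∀ v ∈ a.support, v.1 < i) →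
      Finsupp.single (⟨i, j⟩ : Idx l) 1 ≺[m] a)
    {K : Type*} [Field K] {τ : GradedAut K (wt l q)} (hτ : τ ∈ upperTriangular l q K) (v : Idx l)
    (e : Idx l →₀ ℕ) (he : coeff e (τ.1 (X v)) ≠ 0) : Finsupp.single v 1 ≼[m] e := by
  obtain ⟨i, j⟩ := v
  have hwe : Finsupp.weight (wt l q) e = q i :=
    τ.2 _ _ (isWeightedHomogeneous_X K (wt l q) (⟨i, j⟩ : Idx l)) he
  by_cases h : ∀ v ∈ e.support, v.1 < i
  · exact (h_nonlin i j e hwe h).le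
  · push Not at h
    obtain ⟨⟨i', h'⟩, hu, hi⟩ := h
    have hu0 : e ⟨i', h'⟩ ≠ 0 := Finsupp.mem_support_iff.1 hu
    have h1 : q i' ≤ q i := hwe ▸ Finsupp.le_weight_of_ne_zero' (wt l q) hu0
    obtain rfl : i = i' := le_antisymm hi (hq.le_iff_le.1 h1)
    have h2 := Finsupp.weight_sub_single_add (w := wt l q) hu0
    -- A variable of block `i` already uses up the whole weight `q i`, so `e` is that variable
    -- alone.
    have h3 : Finsupp.weight (wt l q) (e - Finsupp.single ⟨i, h'⟩ 1) = 0 := by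
      have : wt l q ⟨i, h'⟩ = q i := rfl
      omega
    have hnt : Finsupp.NonTorsionWeight ℕ (wt l q) :=
      Finsupp.nonTorsionWeight_of ℕ (w := wt l q) fun v => (hq_pos v.1).ne'
    rw [Finsupp.weight_eq_zero_iff_eq_zero] at h3
    have h4 : e = Finsupp.single ⟨i, h'⟩ 1 := by
      refine le_antisymm (tsub_eq_zero_iff_le.1 h3) ?_
      rw [Finsupp.single_le_iff]
      exact Nat.one_le_iff_ne_zero.2 hu0
    subst h4
    have h5 : h' ≤ j := by
      by_contra hlt
      exact he (hτ i (not_le.1 hlt))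
    rcases h5.eq_or_lt with rfl | h5
    · exact le_rfl
    · exact (h_lin i h' j h5).le

end Fixed

end WeightedGin

theorem mainTheorem4 {K : Type*} [Field K] [CharZero K]
    (n : ℕ) (l q : Fin n → ℕ) (hq_pos : ∀ i, 0 < q i) (hq : StrictMono q)
    (m : MonomialOrder (WeightedGin.Idx l))
    (h_lin : ∀ (i : Fin n) (j k : Fin (l i)), j < k →
      Finsupp.single (⟨i, k⟩ : WeightedGin.Idx l) 1 ≺[m]
        Finsupp.single (⟨i, j⟩ : WeightedGin.Idx l) 1)
    (h_nonlin : ∀ (i : Fin n) (j : Fin (l i)) (a : WeightedGin.Idx l →₀ ℕ),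
      Finsupp.weight (WeightedGin.wt l q) a = q i → (∀ v ∈ a.support, v.1 < i) →
      Finsupp.single (⟨i, j⟩ : WeightedGin.Idx l) 1 ≺[m] a)
    (I : Ideal (MvPolynomial (WeightedGin.Idx l) K))
    (hI : I.IsHomogeneous (weightedHomogeneousSubmodule K (WeightedGin.wt l q))) :
    (∃! J : Ideal (MvPolynomial (WeightedGin.Idx l) K),
      WeightedGin.IsGin m (WeightedGin.wt l q) I J) ∧
    ∀ J : Ideal (MvPolynomial (WeightedGin.Idx l) K),
      WeightedGin.IsGin m (WeightedGin.wt l q) I J →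
      ∀ φ ∈ WeightedGin.upperTriangular l q K, J.map φ.1 = J := by
  have hw : ∀ v : WeightedGin.Idx l, WeightedGin.wt l q v ≠ 0 := fun v => (hq_pos v.1).ne'
  have hI' : WeightedGin.HasComponents (WeightedGin.wt l q) I := fun d f hf => by
    rw [← weightedDecomposition.decompose'_apply]
    exact hI d hf
  have : Infinite K := CharZero.infinite K
  obtain ⟨J, hJ⟩ := WeightedGin.exists_isGin hw m hI'
  refine ⟨⟨J, hJ, fun J' hJ' => hJ'.unique hw hJ⟩, fun J' hJ' τ hτ => ?_⟩
  exact hJ'.map_eq hw hI' τ (WeightedGin.le_of_coeff_map_monomial_ne_zero m τ.1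
    (WeightedGin.single_le_of_mem_upperTriangular hq_pos hq m h_lin h_nonlin hτ))
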